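/- Let $n$ and $d$ be positive integers with $d<n$. A sparse anti-magic square of order $n$ with density $d$, denoted SAMS$(n,d)$, is an $n\times n$ array with entries in $\{0,1,\dots,nd\}$ such that each element of $\{1,2,\dots,nd\}$ occurs in exactly one cell, and such that the set of all row sums, column sums and the two main diagonal sums consists of $2n+2$ consecutive integers. It is called regular if each row, each column and each of the two main diagonals contains exactly $d$ positive entries. Theorem. For every integer $n\ge 11$ with $n\equiv 1$ or $5\pmod 6$ and every integer $d$ with $6\le d\le n-3$, there exists a regular SAMS$(n,d)$. -/

import Mathlib

namespace SparseSquare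

/-- Sum of the entries in row `i`. -/
def rowSum {n : ℕ} (A : Matrix (Fin n) (Fin n) ℕ) (i : Fin n) : ℕ := ∑ j, A i j

/-- Sum of the entries in column `j`. -/
def colSum {n : ℕ} (A : Matrix (Fin n) (Fin n) ℕ) (j : Fin n) : ℕ := ∑ i, A i j

/-- Sum along the left diagonal (from upper left to lower right). -/
def leftDiagSum {n : ℕ} (A : Matrix (Fin n) (Fin n) ℕ) : ℕ := ∑ i, A i i

/-- Sum along the right diagonal (from upper right to lower left);
`Fin.rev i` is the index `n - 1 - i`. -/
def rightDiagSum {n : ℕ} (A : Matrix (Fin n) (Fin n) ℕ) : ℕ := ∑ i : Fin n, A i i.rev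

/-- The sum set of `A`: the set of all row-sums, column-sums and the two main diagonal sums. -/
def sumSet {n : ℕ} (A : Matrix (Fin n) (Fin n) ℕ) : Set ℕ :=
  Set.range (rowSum A) ∪ Set.range (colSum A) ∪ {leftDiagSum A, rightDiagSum A}

/-- `A` is a sparse anti-magic square of order `n` with density `d`, where `0 < d < n`. -/
structure IsSAMS (n d : ℕ) (A : Matrix (Fin n) (Fin n) ℕ) : Prop where
  density_pos : 0 < d
  density_lt : d < n
  /-- The entries are taken from `{0, 1, ..., nd}`. -/
  entry_le : ∀ i j, A i j ≤ n * d
  /-- Each of `1, ..., nd` occurs in exactly one cell. -/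
  occurs_once : ∀ k ∈ Set.Icc 1 (n * d), ∃! p : Fin n × Fin n, A p.1 p.2 = k
  /-- The sum set consists of `2n + 2` consecutive integers. -/
  sumSet_consecutive : ∃ a : ℕ, sumSet A = Set.Icc a (a + (2 * n + 1))

/-- A sparse anti-magic square is regular if each row, each column and each of the two main
diagonals contains exactly `d` positive entries. -/
structure IsRegularSAMS (n d : ℕ) (A : Matrix (Fin n) (Fin n) ℕ) : Prop
    extends IsSAMS n d A where
  row_count : ∀ i, (Finset.univ.filter fun j => 0 < A i j).card = d
  col_count : ∀ j, (Finset.univ.filter fun i => 0 < A i j).card = d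
  leftDiag_count : (Finset.univ.filter fun i => 0 < A i i).card = d
  rightDiag_count : (Finset.univ.filter fun i : Fin n => 0 < A i i.rev).card = d

end SparseSquare

namespace SparseSquare

open ZMod

/-! Index rows and columns by residues mod n and call j - 2i - η the class of the cell (i, j). Since
n is prime to 6, the numbers 1, 2, 3 are units, so a class meets every row, every column and both
diagonals exactly once; filling d classes and leaving the rest empty makes the square regular.

Give each filled class its own block of n consecutive integers out of 1, ..., nd, and write an entry
as the block's midpoint plus `F c x`, where `F c` is a bijection onto [-m, m] and n = 2m + 1. The
midpoints add the same constant to every line, so only the sums of `F` matter: they must fill the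
interval [-n, n + 1].

Here `F c` is built from the ramp `valMinAbs`, the representative of a residue in [-m, m]. Signed,
half-integrally shifted ramps on 4, 5, 6 or 7 classes give the required sums
(`exists_isFilling_four` to `exists_isFilling_seven`, `sums_even`, `sums_odd`). Blocks of four
consecutive classes with all sums zero (`exists_isFilling_zero`) then raise d in steps of 4, and
`IsFilling.exists_isRegularSAMS` turns the filling into a square. -/

/-- A family of functions `F c : ZMod n → [-m, m]`, one for every diagonal class `c ∈ C`, with
prescribed row sums, column sums and diagonal sums. Here `e` plays the role of `1 / 6`. -/
structure IsFilling {n : ℕ} (m : ℤ) (e α β : ZMod n) (C : Finset ℤ) (F : ℤ → ZMod n → ℤ)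
    (R Y : ZMod n → ℤ) (D₁ D₂ : ℤ) : Prop where
  inj : ∀ c ∈ C, Function.Injective (F c)
  lower : ∀ c ∈ C, ∀ x, -m ≤ F c x
  upper : ∀ c ∈ C, ∀ x, F c x ≤ m
  row : ∀ x, ∑ c ∈ C, F c x = R x
  col : ∀ y, ∑ c ∈ C, F c (y - 3 * e * c) = Y y
  diag : ∑ c ∈ C, F c (α - c) = D₁
  antidiag : ∑ c ∈ C, F c (β - 2 * e * c) = D₂

theorem IsFilling.union {n : ℕ} {m : ℤ} {e α β : ZMod n} {C C' : Finset ℤ}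
    {F F' : ℤ → ZMod n → ℤ} {R Y : ZMod n → ℤ} {D₁ D₂ : ℤ}
    (h : IsFilling m e α β C F R Y D₁ D₂) (h' : IsFilling m e α β C' F' 0 0 0 0)
    (hd : Disjoint C C') :
    IsFilling m e α β (C ∪ C') (fun c => if c ∈ C then F c else F' c) R Y D₁ D₂ := by
  have key : ∀ g : ℤ → ZMod n,
      ∑ c ∈ C ∪ C', (if c ∈ C then F c else F' c) (g c)
        = ∑ c ∈ C, F c (g c) + ∑ c ∈ C', F' c (g c) := by
    intro g
    rw [Finset.sum_union hd]
    congr 1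
    · exact Finset.sum_congr rfl fun c hc => by rw [if_pos hc]
    · exact Finset.sum_congr rfl fun c hc => by
        rw [if_neg (Finset.disjoint_right.mp hd hc)]
  have mem : ∀ c ∈ C ∪ C', c ∉ C → c ∈ C' := fun c hc hn =>
    (Finset.mem_union.mp hc).resolve_left hn
  refine ⟨?_, ?_, ?_, ?_, ?_, ?_, ?_⟩
  · intro c hc
    by_cases hC : c ∈ C
    · simpa only [if_pos hC] using h.inj c hC
    · simpa only [if_neg hC] using h'.inj c (mem c hc hC)
  · intro c hc x
    by_cases hC : c ∈ C
    · simpa only [if_pos hC] using h.lower c hC x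
    · simpa only [if_neg hC] using h'.lower c (mem c hc hC) x
  · intro c hc x
    by_cases hC : c ∈ C
    · simpa only [if_pos hC] using h.upper c hC x
    · simpa only [if_neg hC] using h'.upper c (mem c hc hC) x
  · intro x
    rw [key fun _ => x, h.row, h'.row, Pi.zero_apply, add_zero]
  · intro y
    rw [key fun c => y - 3 * e * c, h.col, h'.col, Pi.zero_apply, add_zero]
  · rw [key fun c => α - c, h.diag, h'.diag, add_zero]
  · rw [key fun c => β - 2 * e * c, h.antidiag, h'.antidiag, add_zero]

/-! ### The ramp function -/

theorem valMinAbs_lower {n : ℕ} [NeZero n] {m : ℤ} (hm : (n : ℤ) = 2 * m + 1) (x : ZMod n) :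
    -m ≤ x.valMinAbs := by
  have := (valMinAbs_mem_Ioc x).1
  omega

theorem valMinAbs_upper {n : ℕ} [NeZero n] {m : ℤ} (hm : (n : ℤ) = 2 * m + 1) (x : ZMod n) :
    x.valMinAbs ≤ m := by
  have := (valMinAbs_mem_Ioc x).2
  omega

theorem valMinAbs_eq {n : ℕ} [NeZero n] {m : ℤ} (hm : (n : ℤ) = 2 * m + 1) {x : ZMod n} (v : ℤ)
    (hx : x = v) (h₁ : -m ≤ v) (h₂ : v ≤ m) : x.valMinAbs = v :=
  (valMinAbs_spec x v).mpr ⟨hx, by constructor <;> omega⟩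

theorem valMinAbs_sub_intCast {n : ℕ} [NeZero n] {m : ℤ} (hm : (n : ℤ) = 2 * m + 1) (x : ZMod n)
    (k : ℤ) (h₁ : -m ≤ x.valMinAbs - k) (h₂ : x.valMinAbs - k ≤ m) :
    (x - k).valMinAbs = x.valMinAbs - k :=
  valMinAbs_eq hm _ (by push_cast; simp) h₁ h₂

/-- Any ramp whose slope is a unit is injective; slope 3 is the case needed. -/
theorem injective_valMinAbs_affine {n : ℕ} {u v : ZMod n} (huv : u * v = 1) (w : ZMod n) :
    Function.Injective fun x : ZMod n => (u * x + w).valMinAbs := by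
  intro x y h
  have h := injective_valMinAbs h
  linear_combination v * h - (x - y) * huv

/-! ### Zero-sum blocks of four classes -/

/-- Four consecutive classes can be filled so that every sum vanishes. -/
theorem exists_isFilling_zero {n : ℕ} [NeZero n] {m : ℤ} (hm : (n : ℤ) = 2 * m + 1) (hn : 9 ≤ n)
    {e : ZMod n} (he : 6 * e = 1) (α β : ZMod n) (a : ℤ) :
    ∃ F, IsFilling m e α β {a, a + 1, a + 2, a + 3} F 0 0 0 0 := by
  set z : ZMod n := 3 * (α - a) with hz
  set z' : ZMod n := 3 * (β - 2 * e * a) with hz'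
  -- At most eight values of w are excluded, and n ≥ 9. Avoiding them keeps the ramp from wrapping
  -- around at the points z + w, z + w - 3, z + w - 6 and z' + w, z' + w ± 1 used by the two
  -- diagonals.
  obtain ⟨w, hw⟩ : ∃ w : ZMod n, w ∉ (Finset.range 6).image (fun t : ℕ => (t : ZMod n) - (m : ℤ) - z)
      ∪ {((m : ℤ) : ZMod n) - z', -((m : ℤ) : ZMod n) - z'} := by
    by_contra! hall
    have h1 : (Finset.univ : Finset (ZMod n)).card ≤ 8 := by
      rw [← Finset.eq_univ_iff_forall.mpr hall]
      refine (Finset.card_union_le _ _).trans ?_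
      have h2 := Finset.card_image_le (s := Finset.range 6)
        (f := fun t : ℕ => (t : ZMod n) - (m : ℤ) - z)
      have h3 := Finset.card_le_two (a := ((m : ℤ) : ZMod n) - z') (b := -((m : ℤ) : ZMod n) - z')
      rw [Finset.card_range] at h2
      omega
    rw [Finset.card_univ, ZMod.card] at h1
    omega
  simp only [Finset.mem_union, Finset.mem_image, Finset.mem_range, Finset.mem_insert,
    Finset.mem_singleton, not_or, not_exists, not_and] at hw
  obtain ⟨hw₁, hw₂, hw₃⟩ := hw
  have bz : 6 - m ≤ (z + w).valMinAbs := by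
    by_contra! hlt
    have hl := valMinAbs_lower hm (z + w)
    refine hw₁ ((z + w).valMinAbs + m).toNat (by omega) ?_
    have : ((((z + w).valMinAbs + m).toNat : ℤ) : ZMod n) = (z + w) + (m : ℤ) := by
      rw [Int.toNat_of_nonneg (by omega)]; push_cast; simp
    rw [Int.cast_natCast] at this
    rw [this]; ring
  have bz₁ : (z' + w).valMinAbs ≤ m - 1 := by
    by_contra! hlt
    have hl := valMinAbs_upper hm (z' + w)
    have : (z' + w).valMinAbs = m := by omega
    apply hw₂
    rw [← this, coe_valMinAbs]; ring
  have bz₂ : -m + 1 ≤ (z' + w).valMinAbs := by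
    by_contra! hlt
    have hl := valMinAbs_lower hm (z' + w)
    have : (z' + w).valMinAbs = -m := by omega
    apply hw₃
    have h : ((-m : ℤ) : ZMod n) = z' + w := by rw [← this, coe_valMinAbs]
    push_cast at h
    rw [h]; ring
  have bu := valMinAbs_upper hm (z + w)
  have e3 := valMinAbs_sub_intCast hm (z + w) 3 (by omega) (by omega)
  have e6 := valMinAbs_sub_intCast hm (z + w) 6 (by omega) (by omega)
  have e1 := valMinAbs_sub_intCast hm (z' + w) 1 (by omega) (by omega)
  have e1' := valMinAbs_sub_intCast hm (z' + w) (-1) (by omega) (by omega)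
  push_cast at e3 e6 e1 e1'
  set f : ZMod n → ℤ := fun x => (3 * x + w).valMinAbs with hf
  have finj : Function.Injective f :=
    injective_valMinAbs_affine (v := 2 * e) (by linear_combination he) w
  have finj' : Function.Injective fun x => f (x + 1) := finj.comp (add_left_injective 1)
  have fl : ∀ x, -m ≤ f x := fun x => valMinAbs_lower hm _
  have fu : ∀ x, f x ≤ m := fun x => valMinAbs_upper hm _
  set F : ℤ → ZMod n → ℤ := fun c x =>
    if c = a then f x else if c = a + 1 then -f x else if c = a + 2 then -f (x + 1)
      else f (x + 1) with hF
  have F0 : F a = f := by simp [hF]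
  have F1 : F (a + 1) = fun x => -f x := by simp [hF]
  have F2 : F (a + 2) = fun x => -f (x + 1) := by simp [hF]
  have F3 : F (a + 3) = fun x => f (x + 1) := by simp [hF]
  have hsum : ∀ g : ℤ → ZMod n, ∑ c ∈ ({a, a + 1, a + 2, a + 3} : Finset ℤ), F c (g c)
      = f (g a) - f (g (a + 1)) - f (g (a + 2) + 1) + f (g (a + 3) + 1) := by
    intro g
    rw [Finset.sum_insert (by simp), Finset.sum_insert (by simp), Finset.sum_insert (by simp),
      Finset.sum_singleton, F0, F1, F2, F3]
    ring
  have hall : ∀ p : (ZMod n → ℤ) → Prop, p f → p (fun x => -f x) → p (fun x => -f (x + 1)) →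
      p (fun x => f (x + 1)) → ∀ c ∈ ({a, a + 1, a + 2, a + 3} : Finset ℤ), p (F c) := by
    intro p h0 h1 h2 h3 c hc
    simp only [Finset.mem_insert, Finset.mem_singleton] at hc
    rcases hc with rfl | rfl | rfl | rfl
    · rwa [F0]
    · rwa [F1]
    · rwa [F2]
    · rwa [F3]
  refine ⟨F, ?_, ?_, ?_, ?_, ?_, ?_, ?_⟩
  · exact hall _ finj (neg_injective.comp finj) (neg_injective.comp finj') finj'
  · exact hall (fun g => ∀ x, -m ≤ g x) fl (fun x => neg_le_neg (fu x))
      (fun x => neg_le_neg (fu _)) (fun x => fl _)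
  · exact hall (fun g => ∀ x, g x ≤ m) fu (fun x => neg_le.mpr (fl x))
      (fun x => neg_le.mpr (fl _)) (fun x => fu _)
  · intro x
    rw [hsum fun _ => x, Pi.zero_apply]
    ring
  · intro y
    rw [hsum fun c => y - 3 * e * c, Pi.zero_apply]
    -- As 3e = 1/2, advancing the class by 2 moves the argument by -1, which the shift x + 1 undoes;
    -- so class a cancels a + 2, and a + 1 cancels a + 3.
    have h2 : y - 3 * e * ((a + 2 : ℤ) : ZMod n) + 1 = y - 3 * e * (a : ℤ) := by
      push_cast; linear_combination -he
    have h3 : y - 3 * e * ((a + 3 : ℤ) : ZMod n) + 1 = y - 3 * e * ((a + 1 : ℤ) : ZMod n) := by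
      push_cast; linear_combination -he
    rw [h2, h3]
    ring
  · rw [hsum fun c => α - c]
    simp only [hf]
    -- A second difference with step 3, zero because the ramp is affine here. The other diagonal is
    -- likewise a second difference, with step 1.
    have h0 : 3 * (α - (a : ℤ)) + w = z + w := by rw [hz]
    have h1 : 3 * (α - ((a + 1 : ℤ) : ZMod n)) + w = z + w - 3 := by rw [hz]; push_cast; ring
    have h2 : 3 * (α - ((a + 2 : ℤ) : ZMod n) + 1) + w = z + w - 3 := by rw [hz]; push_cast; ring
    have h3 : 3 * (α - ((a + 3 : ℤ) : ZMod n) + 1) + w = z + w - 6 := by rw [hz]; push_cast; ring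
    rw [h0, h1, h2, h3, e3, e6]
    ring
  · rw [hsum fun c => β - 2 * e * c]
    simp only [hf]
    have h0 : 3 * (β - 2 * e * (a : ℤ)) + w = z' + w := by rw [hz']
    have h1 : 3 * (β - 2 * e * ((a + 1 : ℤ) : ZMod n)) + w = z' + w - 1 := by
      rw [hz']; push_cast; linear_combination -he
    have h2 : 3 * (β - 2 * e * ((a + 2 : ℤ) : ZMod n) + 1) + w = z' + w - (-1) := by
      rw [hz']; push_cast; linear_combination -2 * he
    have h3 : 3 * (β - 2 * e * ((a + 3 : ℤ) : ZMod n) + 1) + w = z' + w := by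
      rw [hz']; push_cast; linear_combination -3 * he
    rw [h0, h1, h2, h3, e1, e1']
    ring

/-- A filling can be enlarged by `q` runs of four consecutive classes without changing its sums. -/
theorem IsFilling.exists_extension {n : ℕ} [NeZero n] {m : ℤ} (hm : (n : ℤ) = 2 * m + 1)
    (hn : 9 ≤ n) {e α β : ZMod n} (he : 6 * e = 1) {C : Finset ℤ} {F : ℤ → ZMod n → ℤ}
    {R Y : ZMod n → ℤ} {D₁ D₂ : ℤ} (h : IsFilling m e α β C F R Y D₁ D₂) {a b : ℤ}
    (hab : a ≤ b) (hC : C ⊆ Finset.Ico a b) (q : ℕ) :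
    ∃ C' F', IsFilling m e α β C' F' R Y D₁ D₂ ∧ C'.card = C.card + 4 * q ∧
      C' ⊆ Finset.Ico a (b + 4 * q) := by
  induction q with
  | zero => exact ⟨C, F, h, by simp, by simpa using hC⟩
  | succ q ih =>
    obtain ⟨C', F', h', hcard, hsub⟩ := ih
    obtain ⟨G, hG⟩ := exists_isFilling_zero hm hn he α β (b + 4 * q)
    have hd : Disjoint C' {b + 4 * (q : ℤ), b + 4 * q + 1, b + 4 * q + 2, b + 4 * q + 3} := by
      rw [Finset.disjoint_left]
      intro c hc hc'
      have := Finset.mem_Ico.mp (hsub hc)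
      simp only [Finset.mem_insert, Finset.mem_singleton] at hc'
      omega
    refine ⟨_, _, h'.union hG hd, ?_, ?_⟩
    · rw [Finset.card_union_of_disjoint hd, hcard, Finset.card_insert_of_notMem (by simp),
        Finset.card_insert_of_notMem (by simp), Finset.card_insert_of_notMem (by simp),
        Finset.card_singleton]
      ring
    · intro c hc
      rw [Finset.mem_Ico]
      rcases Finset.mem_union.mp hc with hc | hc
      · have := Finset.mem_Ico.mp (hsub hc)
        push_cast
        omega
      · simp only [Finset.mem_insert, Finset.mem_singleton] at hc
        push_cast
        omega

/-! ### Base fillings with 4, 5, 6 and 7 classes -/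

theorem valMinAbs_mul {n : ℕ} [NeZero n] {m : ℤ} (hm : (n : ℤ) = 2 * m + 1) {e : ZMod n} {E : ℤ}
    (hE : e = E) (K t : ℤ) (h₁ : -m ≤ E * K - n * t) (h₂ : E * K - n * t ≤ m) :
    (e * K).valMinAbs = E * K - n * t :=
  valMinAbs_eq hm _ (by rw [hE]; push_cast; simp) h₁ h₂

/-- A filling of the classes in `C` by signed and shifted ramps. -/
theorem isFilling_valMinAbs {n : ℕ} [NeZero n] {m : ℤ} (hm : (n : ℤ) = 2 * m + 1) {e : ZMod n}
    (he : 6 * e = 1) (C : Finset ℤ) (σ s : ℤ → ℤ) (hσ : ∀ c ∈ C, σ c = 1 ∨ σ c = -1) (A B : ℤ) :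
    IsFilling m e (e * (3 * A : ℤ)) (e * B) C (fun c x => σ c * (x - e * (3 * s c : ℤ)).valMinAbs)
      (fun x => ∑ c ∈ C, σ c * (x - e * (3 * s c : ℤ)).valMinAbs)
      (fun y => ∑ c ∈ C, σ c * (y - e * (3 * (s c + c) : ℤ)).valMinAbs)
      (∑ c ∈ C, σ c * (e * (3 * (A - s c - 2 * c) : ℤ)).valMinAbs)
      (∑ c ∈ C, σ c * (e * (B - 2 * c - 3 * s c : ℤ)).valMinAbs) where
  inj c hc x y h := by
    have h : σ c * (x - e * (3 * s c : ℤ)).valMinAbs = σ c * (y - e * (3 * s c : ℤ)).valMinAbs := h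
    have h := injective_valMinAbs
      (mul_left_cancel₀ (by rcases hσ c hc with h | h <;> rw [h] <;> norm_num) h)
    exact sub_left_injective h
  lower c hc x := by
    have h₁ := valMinAbs_lower hm (x - e * (3 * s c : ℤ))
    have h₂ := valMinAbs_upper hm (x - e * (3 * s c : ℤ))
    rcases hσ c hc with h | h <;> rw [h] <;> linarith
  upper c hc x := by
    have h₁ := valMinAbs_lower hm (x - e * (3 * s c : ℤ))
    have h₂ := valMinAbs_upper hm (x - e * (3 * s c : ℤ))
    rcases hσ c hc with h | h <;> rw [h] <;> linarith
  row x := rfl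
  col y := Finset.sum_congr rfl fun c _ => by
    congr 2; push_cast; ring
  diag := Finset.sum_congr rfl fun c _ => by
    congr 2; push_cast; linear_combination (c : ZMod n) * he
  antidiag := Finset.sum_congr rfl fun c _ => by
    congr 2; push_cast; ring

theorem IsFilling.congr {n : ℕ} {m : ℤ} {e α β : ZMod n} {C : Finset ℤ} {F : ℤ → ZMod n → ℤ}
    {R R' Y Y' : ZMod n → ℤ} {D₁ D₁' D₂ D₂' : ℤ} (h : IsFilling m e α β C F R Y D₁ D₂)
    (hR : ∀ x, R x = R' x) (hY : ∀ y, Y y = Y' y) (h₁ : D₁ = D₁') (h₂ : D₂ = D₂') :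
    IsFilling m e α β C F R' Y' D₁' D₂' := by
  obtain rfl : R = R' := funext hR
  obtain rfl : Y = Y' := funext hY
  rwa [← h₁, ← h₂]

/-- The shift s contributes a ramp displaced by s/2 to the row sums and by (s + c)/2 to the column
sums, so choosing signs and shifts is a matter of cancelling multisets of s and of s + c. The
constants A and B then position the diagonals. The same scheme serves 5, 6 and 7 classes. -/
theorem exists_isFilling_four {n : ℕ} [NeZero n] {m : ℤ} (hm : (n : ℤ) = 2 * m + 1)
    {e : ZMod n} (he : 6 * e = 1) {l E : ℤ} (hl : 2 ≤ l) (hE : e = E)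
    (hlE : (n : ℤ) = 6 * l + 1 ∧ E = -l ∨ (n : ℤ) = 6 * l - 1 ∧ E = l) :
    ∃ α β F, IsFilling m e α β {-3, 0, 2, 1} F
      (fun x => 2 * x.valMinAbs + (x - e * 9).valMinAbs - (x - e * 3).valMinAbs)
      (fun y => 2 * y.valMinAbs) n 1 := by
  have h := isFilling_valMinAbs hm he {-3, 0, 2, 1}
    (fun c => if c = -3 ∨ c = 0 ∨ c = 2 then 1 else -1)
    (fun c => if c = -3 then 3 else if c = 0 then 0 else if c = 2 then 0 else 1)
    (fun c _ => by split_ifs <;> simp) (-1) 4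
  -- The ramp at K/6 becomes a function of the integer K, so its arguments reduce to numerals; the
  -- second argument t of `hr` is the multiple of n removed from E * K to land in [-m, m].
  obtain ⟨g, hg⟩ : ∃ g : ℤ → ℤ, ∀ K : ℤ, (e * K).valMinAbs = g K := ⟨_, fun _ => rfl⟩
  have hr := fun K t h₁ h₂ => (hg K).symm.trans (valMinAbs_mul hm hE K t h₁ h₂)
  refine ⟨_, _, _, h.congr (fun x => ?_) (fun y => ?_) ?_ ?_⟩
  · norm_num
    ring
  · norm_num
    ring
  · simp only [hg]
    norm_num
    rcases hlE with ⟨hn, rfl⟩ | ⟨hn, rfl⟩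
    · simp only [hr 6 (-1) (by omega) (by omega), hr (-3) 0 (by omega) (by omega),
        hr (-15) 2 (by omega) (by omega), hr (-12) 2 (by omega) (by omega)]
      omega
    · simp only [hr 6 1 (by omega) (by omega), hr (-3) (-1) (by omega) (by omega),
        hr (-15) (-3) (by omega) (by omega), hr (-12) (-2) (by omega) (by omega)]
      omega
  · simp only [hg]
    norm_num
    rcases hlE with ⟨hn, rfl⟩ | ⟨hn, rfl⟩
    · simp only [hr 1 0 (by omega) (by omega), hr 4 (-1) (by omega) (by omega),
        hr 0 0 (by omega) (by omega), hr (-1) 0 (by omega) (by omega)]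
      omega
    · simp only [hr 1 0 (by omega) (by omega), hr 4 1 (by omega) (by omega),
        hr 0 0 (by omega) (by omega), hr (-1) 0 (by omega) (by omega)]
      omega

theorem exists_isFilling_five {n : ℕ} [NeZero n] {m : ℤ} (hm : (n : ℤ) = 2 * m + 1)
    {e : ZMod n} (he : 6 * e = 1) {l E : ℤ} (hl : 2 ≤ l) (hE : e = E)
    (hlE : (n : ℤ) = 6 * l + 1 ∧ E = -l ∨ (n : ℤ) = 6 * l - 1 ∧ E = l) :
    ∃ α β F, IsFilling m e α β {-1, -4, 2, -2, 1} F
      (fun x => x.valMinAbs + (x - e * 9).valMinAbs - (x - e * 3).valMinAbs)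
      (fun y => 2 * (y + e * 3).valMinAbs - (y + e * 6).valMinAbs) 0 (n + 1) := by
  have h := isFilling_valMinAbs hm he {-1, -4, 2, -2, 1}
    (fun c => if c = -1 ∨ c = -4 ∨ c = 2 then 1 else -1)
    (fun c => if c = -1 then 0 else if c = -4 then 3 else if c = 2 then -3 else if c = -2 then 1 else -3)
    (fun c _ => by split_ifs <;> simp) (-2) 8
  obtain ⟨g, hg⟩ : ∃ g : ℤ → ℤ, ∀ K : ℤ, (e * K).valMinAbs = g K := ⟨_, fun _ => rfl⟩
  have hr := fun K t h₁ h₂ => (hg K).symm.trans (valMinAbs_mul hm hE K t h₁ h₂)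
  refine ⟨_, _, _, h.congr (fun x => ?_) (fun y => ?_) ?_ ?_⟩
  · norm_num
    ring
  · norm_num
    ring
  · simp only [hg]
    norm_num
    rcases hlE with ⟨hn, rfl⟩ | ⟨hn, rfl⟩
    · simp only [hr 0 0 (by omega) (by omega), hr 9 (-1) (by omega) (by omega),
        hr (-9) 1 (by omega) (by omega), hr 3 0 (by omega) (by omega),
        hr (-3) 0 (by omega) (by omega)]
      omega
    · simp only [hr 0 0 (by omega) (by omega), hr 9 2 (by omega) (by omega),
        hr (-9) (-2) (by omega) (by omega), hr 3 1 (by omega) (by omega),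
        hr (-3) (-1) (by omega) (by omega)]
      omega
  · simp only [hg]
    norm_num
    rcases hlE with ⟨hn, rfl⟩ | ⟨hn, rfl⟩
    · simp only [hr 10 (-2) (by omega) (by omega), hr 7 (-1) (by omega) (by omega),
        hr 13 (-2) (by omega) (by omega), hr 9 (-1) (by omega) (by omega),
        hr 15 (-2) (by omega) (by omega)]
      omega
    · simp only [hr 10 2 (by omega) (by omega), hr 7 1 (by omega) (by omega),
        hr 13 2 (by omega) (by omega), hr 9 2 (by omega) (by omega),
        hr 15 3 (by omega) (by omega)]
      omega

theorem exists_isFilling_six {n : ℕ} [NeZero n] {m : ℤ} (hm : (n : ℤ) = 2 * m + 1)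
    {e : ZMod n} (he : 6 * e = 1) {l E : ℤ} (hl : 2 ≤ l) (hE : e = E)
    (hlE : (n : ℤ) = 6 * l + 1 ∧ E = -l ∨ (n : ℤ) = 6 * l - 1 ∧ E = l) :
    ∃ α β F, IsFilling m e α β {-1, -4, 0, 2, -2, 1} F
      (fun x => 2 * x.valMinAbs + (x - e * 9).valMinAbs - (x - e * 3).valMinAbs)
      (fun y => 2 * y.valMinAbs) 1 n := by
  have h := isFilling_valMinAbs hm he {-1, -4, 0, 2, -2, 1}
    (fun c => if c = -1 ∨ c = -4 ∨ c = 0 ∨ c = 2 then 1 else -1)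
    (fun c => if c = -1 then 3 else if c = -4 then 4 else if c = 0 then 0 else if c = 2 then 0 else if c = -2 then 4 else 1)
    (fun c _ => by split_ifs <;> simp) 0 1
  obtain ⟨g, hg⟩ : ∃ g : ℤ → ℤ, ∀ K : ℤ, (e * K).valMinAbs = g K := ⟨_, fun _ => rfl⟩
  have hr := fun K t h₁ h₂ => (hg K).symm.trans (valMinAbs_mul hm hE K t h₁ h₂)
  refine ⟨_, _, _, h.congr (fun x => ?_) (fun y => ?_) ?_ ?_⟩
  · norm_num
    ring
  · norm_num
    ring
  · simp only [hg]
    norm_num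
    rcases hlE with ⟨hn, rfl⟩ | ⟨hn, rfl⟩
    · simp only [hr (-3) 0 (by omega) (by omega), hr 12 (-2) (by omega) (by omega),
        hr 0 0 (by omega) (by omega), hr (-12) 2 (by omega) (by omega),
        hr (-9) 1 (by omega) (by omega)]
      omega
    · simp only [hr (-3) (-1) (by omega) (by omega), hr 12 2 (by omega) (by omega),
        hr 0 0 (by omega) (by omega), hr (-12) (-2) (by omega) (by omega),
        hr (-9) (-2) (by omega) (by omega)]
      omega
  · simp only [hg]
    norm_num
    rcases hlE with ⟨hn, rfl⟩ | ⟨hn, rfl⟩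
    · simp only [hr (-6) 1 (by omega) (by omega), hr (-3) 0 (by omega) (by omega),
        hr 1 0 (by omega) (by omega), hr (-7) 1 (by omega) (by omega),
        hr (-4) 1 (by omega) (by omega)]
      omega
    · simp only [hr (-6) (-1) (by omega) (by omega), hr (-3) (-1) (by omega) (by omega),
        hr 1 0 (by omega) (by omega), hr (-7) (-1) (by omega) (by omega),
        hr (-4) (-1) (by omega) (by omega)]
      omega

theorem exists_isFilling_seven {n : ℕ} [NeZero n] {m : ℤ} (hm : (n : ℤ) = 2 * m + 1)
    {e : ZMod n} (he : 6 * e = 1) {l E : ℤ} (hl : 2 ≤ l) (hE : e = E)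
    (hlE : (n : ℤ) = 6 * l + 1 ∧ E = -l ∨ (n : ℤ) = 6 * l - 1 ∧ E = l) :
    ∃ α β F, IsFilling m e α β {-1, -2, -5, 0, -3, -4, 1} F
      (fun x => x.valMinAbs + (x - e * 9).valMinAbs - (x - e * 3).valMinAbs)
      (fun y => 2 * (y + e * 3).valMinAbs - (y + e * 6).valMinAbs) (n + 1) 0 := by
  have h := isFilling_valMinAbs hm he {-1, -2, -5, 0, -3, -4, 1}
    (fun c => if c = -1 ∨ c = -2 ∨ c = -5 ∨ c = 0 then 1 else -1)
    (fun c => if c = -1 then 0 else if c = -2 then 2 else if c = -5 then 4 else if c = 0 then 3 else if c = -3 then 1 else if c = -4 then 4 else 2)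
    (fun c _ => by split_ifs <;> simp) 0 2
  obtain ⟨g, hg⟩ : ∃ g : ℤ → ℤ, ∀ K : ℤ, (e * K).valMinAbs = g K := ⟨_, fun _ => rfl⟩
  have hr := fun K t h₁ h₂ => (hg K).symm.trans (valMinAbs_mul hm hE K t h₁ h₂)
  refine ⟨_, _, _, h.congr (fun x => ?_) (fun y => ?_) ?_ ?_⟩
  · norm_num
    ring
  · norm_num
    ring
  · simp only [hg]
    norm_num
    rcases hlE with ⟨hn, rfl⟩ | ⟨hn, rfl⟩
    · simp only [hr 6 (-1) (by omega) (by omega), hr 18 (-3) (by omega) (by omega),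
        hr (-9) 1 (by omega) (by omega), hr 15 (-2) (by omega) (by omega),
        hr 12 (-2) (by omega) (by omega), hr (-12) 2 (by omega) (by omega)]
      omega
    · simp only [hr 6 1 (by omega) (by omega), hr 18 3 (by omega) (by omega),
        hr (-9) (-2) (by omega) (by omega), hr 15 3 (by omega) (by omega),
        hr 12 2 (by omega) (by omega), hr (-12) (-2) (by omega) (by omega)]
      omega
  · simp only [hg]
    norm_num
    rcases hlE with ⟨hn, rfl⟩ | ⟨hn, rfl⟩
    · simp only [hr 4 (-1) (by omega) (by omega), hr 0 0 (by omega) (by omega),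
        hr (-7) 1 (by omega) (by omega), hr 5 (-1) (by omega) (by omega),
        hr (-2) 0 (by omega) (by omega), hr (-6) 1 (by omega) (by omega)]
      omega
    · simp only [hr 4 1 (by omega) (by omega), hr 0 0 (by omega) (by omega),
        hr (-7) (-1) (by omega) (by omega), hr 5 1 (by omega) (by omega),
        hr (-2) 0 (by omega) (by omega), hr (-6) (-1) (by omega) (by omega)]
      omega

/-! ### The values of the row and column sums -/

/-- With v the ramp at x, the two displaced ramps differ by -1 except at v = 1, where one wraps.
Rows give the odd numbers 2v - 1 from -n to n - 2 without 1, and also n + 1; columns give the even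
numbers from 1 - n to n - 1. Only 1 and n remain, for the diagonals. -/
theorem sums_even {n : ℕ} [NeZero n] {m : ℤ} (hm : (n : ℤ) = 2 * m + 1) (hm₁ : 1 ≤ m) {e : ZMod n}
    (he : 6 * e = 1) :
    Set.range (fun x : ZMod n => 2 * x.valMinAbs + (x - e * 9).valMinAbs - (x - e * 3).valMinAbs) ∪
      Set.range (fun y : ZMod n => 2 * y.valMinAbs) ∪ {(n : ℤ), 1} = Set.Icc (-n : ℤ) (n + 1) := by
  have hn : (2 * m + 1 : ZMod n) = 0 := by
    have : ((n : ℤ) : ZMod n) = ((2 * m + 1 : ℤ) : ZMod n) := by rw [hm]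
    push_cast at this
    rw [← this, natCast_self]
  -- Modulo n = 2m + 1 one has 1/2 = m + 1, and below 3/2 = m + 2.
  have h3 : e * 3 = m + 1 := by linear_combination (m + 1) * he - 3 * e * hn
  have hR : ∀ x : ZMod n, 2 * x.valMinAbs + (x - e * 9).valMinAbs - (x - e * 3).valMinAbs =
      if x.valMinAbs = 1 then (n : ℤ) + 1 else 2 * x.valMinAbs - 1 := by
    intro x
    have hl := valMinAbs_lower hm x
    have hu := valMinAbs_upper hm x
    have hx : x = (x.valMinAbs : ZMod n) := (coe_valMinAbs x).symm
    generalize x.valMinAbs = v at *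
    subst hx
    have e9 : e * 9 = m + 2 := by linear_combination 3 * h3 + hn
    rw [h3, e9]
    by_cases h1 : 1 ≤ v
    · rw [valMinAbs_eq hm (x := (v : ZMod n) - (m + 1)) (v - (m + 1)) (by push_cast; rfl)
        (by omega) (by omega)]
      split_ifs with h
      · rw [valMinAbs_eq hm m (by rw [h]; push_cast; linear_combination -hn) (by omega) le_rfl]
        omega
      · rw [valMinAbs_eq hm (v - (m + 2)) (by push_cast; rfl) (by omega) (by omega)]
        omega
    · rw [valMinAbs_eq hm (x := (v : ZMod n) - (m + 1)) (v + m)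
        (by push_cast; linear_combination -hn) (by omega) (by omega),
        valMinAbs_eq hm (v + m - 1) (by push_cast; linear_combination -hn) (by omega) (by omega),
        if_neg (by omega)]
      omega
  ext s
  simp only [Set.mem_union, Set.mem_range, Set.mem_insert_iff, Set.mem_singleton_iff, Set.mem_Icc,
    hR]
  constructor
  · rintro ((⟨x, rfl⟩ | ⟨x, rfl⟩) | rfl | rfl)
    · have hl := valMinAbs_lower hm x
      have hu := valMinAbs_upper hm x
      split_ifs <;> omega
    · have hl := valMinAbs_lower hm x
      have hu := valMinAbs_upper hm x
      omega
    · omega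
    · omega
  · rintro ⟨h₁, h₂⟩
    rcases Int.even_or_odd' s with ⟨k, rfl | rfl⟩
    · by_cases hk : k ≤ m
      · exact Or.inl (Or.inr ⟨k, by rw [valMinAbs_eq hm k rfl (by omega) hk]⟩)
      · refine Or.inl (Or.inl ⟨(1 : ℤ), ?_⟩)
        rw [valMinAbs_eq hm 1 rfl (by omega) hm₁, if_pos rfl]
        omega
    · by_cases hk : k = 0 ∨ k = m
      · omega
      · refine Or.inl (Or.inl ⟨(k + 1 : ℤ), ?_⟩)
        rw [valMinAbs_eq hm (k + 1) (by push_cast; rfl) (by omega) (by omega), if_neg (by omega)]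
        omega

/-- Rows give [-m - 1, m - 1] without 0, and also n; columns give [-n, -m - 2] and [m, n - 1]. Only
0 and n + 1 remain, for the diagonals. -/
theorem sums_odd {n : ℕ} [NeZero n] {m : ℤ} (hm : (n : ℤ) = 2 * m + 1) (hm₁ : 1 ≤ m) {e : ZMod n}
    (he : 6 * e = 1) :
    Set.range (fun x : ZMod n => x.valMinAbs + (x - e * 9).valMinAbs - (x - e * 3).valMinAbs) ∪
      Set.range (fun y : ZMod n => 2 * (y + e * 3).valMinAbs - (y + e * 6).valMinAbs) ∪
        {0, (n : ℤ) + 1} = Set.Icc (-n : ℤ) (n + 1) := by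
  have hn : (2 * m + 1 : ZMod n) = 0 := by
    have : ((n : ℤ) : ZMod n) = ((2 * m + 1 : ℤ) : ZMod n) := by rw [hm]
    push_cast at this
    rw [← this, natCast_self]
  have h3 : e * 3 = m + 1 := by linear_combination (m + 1) * he - 3 * e * hn
  have hR : ∀ x : ZMod n, x.valMinAbs + (x - e * 9).valMinAbs - (x - e * 3).valMinAbs =
      if x.valMinAbs = 1 then (n : ℤ) else x.valMinAbs - 1 := by
    intro x
    have hl := valMinAbs_lower hm x
    have hu := valMinAbs_upper hm x
    have hx : x = (x.valMinAbs : ZMod n) := (coe_valMinAbs x).symm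
    generalize x.valMinAbs = v at *
    subst hx
    have e9 : e * 9 = m + 2 := by linear_combination 3 * h3 + hn
    rw [h3, e9]
    by_cases h1 : 1 ≤ v
    · rw [valMinAbs_eq hm (x := (v : ZMod n) - (m + 1)) (v - (m + 1)) (by push_cast; rfl)
        (by omega) (by omega)]
      split_ifs with h
      · rw [valMinAbs_eq hm m (by rw [h]; push_cast; linear_combination -hn) (by omega) le_rfl]
        omega
      · rw [valMinAbs_eq hm (v - (m + 2)) (by push_cast; rfl) (by omega) (by omega)]
        omega
    · rw [valMinAbs_eq hm (x := (v : ZMod n) - (m + 1)) (v + m)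
        (by push_cast; linear_combination -hn) (by omega) (by omega),
        valMinAbs_eq hm (v + m - 1) (by push_cast; linear_combination -hn) (by omega) (by omega),
        if_neg (by omega)]
      omega
  have hY : ∀ y : ZMod n, 2 * (y + e * 3).valMinAbs - (y + e * 6).valMinAbs =
      if (y + e * 3).valMinAbs < 0 then (y + e * 3).valMinAbs - m - 1
        else (y + e * 3).valMinAbs + m := by
    intro y
    have h6 : y + e * 6 = (y + e * 3) + (m + 1) := by rw [← h3]; ring
    rw [h6]
    generalize y + e * 3 = x
    have hl := valMinAbs_lower hm x
    have hu := valMinAbs_upper hm x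
    have hx : x = (x.valMinAbs : ZMod n) := (coe_valMinAbs x).symm
    generalize x.valMinAbs = v at *
    subst hx
    split_ifs with h
    · rw [valMinAbs_eq hm (v + m + 1) (by push_cast; ring) (by omega) (by omega)]
      omega
    · rw [valMinAbs_eq hm (v - m) (by push_cast; linear_combination hn) (by omega) (by omega)]
      omega
  ext s
  simp only [Set.mem_union, Set.mem_range, Set.mem_insert_iff, Set.mem_singleton_iff, Set.mem_Icc,
    hR, hY]
  constructor
  · rintro ((⟨x, rfl⟩ | ⟨x, rfl⟩) | rfl | rfl)
    · have hl := valMinAbs_lower hm x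
      have hu := valMinAbs_upper hm x
      split_ifs <;> omega
    · have hl := valMinAbs_lower hm (x + e * 3)
      have hu := valMinAbs_upper hm (x + e * 3)
      split_ifs <;> omega
    · omega
    · omega
  · rintro ⟨h₁, h₂⟩
    have row : ∀ k : ℤ, -m ≤ k → k ≤ m → s = (if k = 1 then (n : ℤ) else k - 1) →
        ∃ x : ZMod n, (if x.valMinAbs = 1 then (n : ℤ) else x.valMinAbs - 1) = s := by
      intro k hk₁ hk₂ hs
      exact ⟨k, by rw [valMinAbs_eq hm k rfl hk₁ hk₂, hs]⟩
    have col : ∀ k : ℤ, -m ≤ k → k ≤ m → s = (if k < 0 then k - m - 1 else k + m) →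
        ∃ x : ZMod n, (if (x + e * 3).valMinAbs < 0 then (x + e * 3).valMinAbs - m - 1
          else (x + e * 3).valMinAbs + m) = s := by
      intro k hk₁ hk₂ hs
      exact ⟨k - e * 3, by rw [sub_add_cancel, valMinAbs_eq hm k rfl hk₁ hk₂, hs]⟩
    by_cases c₁ : s ≤ -m - 2
    · exact Or.inl (Or.inr (col (s + m + 1) (by omega) (by omega) (by split_ifs <;> omega)))
    by_cases c₂ : s = n
    · exact Or.inl (Or.inl (row 1 (by omega) (by omega) (by rw [if_pos rfl, c₂])))
    by_cases c₃ : s = 0 ∨ s = n + 1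
    · exact Or.inr c₃
    by_cases c₄ : s < m
    · exact Or.inl (Or.inl (row (s + 1) (by omega) (by omega) (by split_ifs <;> omega)))
    · exact Or.inl (Or.inr (col (s - m) (by omega) (by omega) (by split_ifs <;> omega)))

/-! ### From a filling to a square -/

/-- The residue class of an index. -/
def residue {n : ℕ} (i : Fin n) : ZMod n := ((i : ℕ) : ZMod n)

theorem bijective_residue {n : ℕ} [NeZero n] : Function.Bijective (residue (n := n)) := by
  rw [Fintype.bijective_iff_injective_and_card]
  refine ⟨fun i j h => ?_, by rw [Fintype.card_fin, ZMod.card]⟩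
  have h := (natCast_eq_natCast_iff' _ _ _).mp h
  rw [Nat.mod_eq_of_lt i.2, Nat.mod_eq_of_lt j.2] at h
  exact Fin.ext h

theorem residue_rev {n : ℕ} (i : Fin n) : residue i.rev = -1 - residue i := by
  have h : ((i.rev : ℕ) + (i + 1) : ℕ) = n := by
    rw [Fin.val_rev]; omega
  have h := congrArg (Nat.cast : ℕ → ZMod n) h
  push_cast at h
  rw [natCast_self] at h
  unfold residue
  linear_combination h

theorem sum_residue_ite {n : ℕ} [NeZero n] (v : ZMod n → ℕ) (p : ZMod n → Prop) [DecidablePred p] (a : ZMod n)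
    (hp : ∀ x, p x ↔ x = a) : ∑ i : Fin n, (if p (residue i) then v (residue i) else 0) = v a := by
  rw [bijective_residue.sum_comp fun x : ZMod n => if p x then v x else 0]
  simp only [hp]
  rw [Finset.sum_ite_eq' Finset.univ a v, if_pos (Finset.mem_univ a)]

/-- The square whose cell in row `i` and column `2 i + c + η` contains `V c (i + τ)`, for every
class `c ∈ C`, and whose other cells are empty. -/
def diagonalSquare {n : ℕ} (C : Finset ℤ) (η τ : ZMod n) (V : ℤ → ZMod n → ℕ) :
    Matrix (Fin n) (Fin n) ℕ :=
  fun i j => ∑ c ∈ C, if (c : ZMod n) = residue j - 2 * residue i - η then V c (residue i + τ) else 0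

/-! ### Line sums and positive cells of a union of classes -/

section Sums

variable {n : ℕ} (C : Finset ℤ) (η τ : ZMod n)
  (V : ℤ → ZMod n → ℕ)

theorem diagonalSquare_row [NeZero n] (i : Fin n) :
    ∑ j, diagonalSquare C η τ V i j = ∑ c ∈ C, V c (residue i + τ) := by
  unfold diagonalSquare
  rw [Finset.sum_comm]
  exact Finset.sum_congr rfl fun c _ => sum_residue_ite (fun _ => V c (residue i + τ))
    (fun x => (c : ZMod n) = x - 2 * residue i - η) (c + η + 2 * residue i)
    fun x => ⟨fun h => by rw [h]; ring, fun h => by rw [h]; ring⟩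

theorem diagonalSquare_col [NeZero n] {e : ZMod n} (he : 6 * e = 1) (j : Fin n) :
    ∑ i, diagonalSquare C η τ V i j
      = ∑ c ∈ C, V c (3 * e * (residue j - η) + τ - 3 * e * c) := by
  unfold diagonalSquare
  rw [Finset.sum_comm]
  refine Finset.sum_congr rfl fun c _ => (sum_residue_ite (fun x => V c (x + τ))
    (fun x => (c : ZMod n) = residue j - 2 * x - η) (3 * e * (residue j - η - (c : ZMod n)))
    fun x => ⟨fun h => ?_, fun h => ?_⟩).trans ?_
  · rw [h]; linear_combination -x * he
  · rw [h]; linear_combination (residue j - η - c) * he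
  · congr 1; ring

theorem diagonalSquare_leftDiag [NeZero n] :
    ∑ i, diagonalSquare C η τ V i i = ∑ c ∈ C, V c (τ - η - c) := by
  unfold diagonalSquare
  rw [Finset.sum_comm]
  refine Finset.sum_congr rfl fun c _ => (sum_residue_ite (fun x => V c (x + τ))
    (fun x => (c : ZMod n) = x - 2 * x - η) (-η - (c : ZMod n))
    fun x => ⟨fun h => by rw [h]; ring, fun h => by rw [h]; ring⟩).trans ?_
  congr 1; ring

theorem diagonalSquare_rightDiag [NeZero n] {e : ZMod n} (he : 6 * e = 1) :
    ∑ i : Fin n, diagonalSquare C η τ V i i.rev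
      = ∑ c ∈ C, V c (τ - 2 * e * (1 + η) - 2 * e * c) := by
  unfold diagonalSquare
  simp only [residue_rev]
  rw [Finset.sum_comm]
  refine Finset.sum_congr rfl fun c _ => (sum_residue_ite (fun x => V c (x + τ))
    (fun x => (c : ZMod n) = -1 - x - 2 * x - η) (2 * e * (-1 - η - (c : ZMod n)))
    fun x => ⟨fun h => ?_, fun h => ?_⟩).trans ?_
  · rw [h]; linear_combination -x * he
  · rw [h]; linear_combination (-1 - η - c) * he
  · congr 1; ring

variable {C η τ V}

theorem diagonalSquare_apply (hC : Set.InjOn (fun c : ℤ => (c : ZMod n)) C) {c : ℤ} (hc : c ∈ C)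
    {i j : Fin n} (h : (c : ZMod n) = residue j - 2 * residue i - η) :
    diagonalSquare C η τ V i j = V c (residue i + τ) := by
  unfold diagonalSquare
  rw [Finset.sum_eq_single c, if_pos h]
  · intro b hb hbc
    exact if_neg fun h' => hbc (hC hb hc (h'.trans h.symm))
  · exact fun h => absurd hc h

theorem exists_of_diagonalSquare_pos {i j : Fin n} (h : 0 < diagonalSquare C η τ V i j) :
    ∃ c ∈ C, (c : ZMod n) = residue j - 2 * residue i - η := by
  obtain ⟨c, hc, h'⟩ := Finset.exists_ne_zero_of_sum_ne_zero h.ne'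
  exact ⟨c, hc, by by_contra hne; exact h' (if_neg hne)⟩

/-- Reduces counting positive cells on a line to the line sum of the square with constant value 1.
-/
theorem ite_diagonalSquare_pos (hC : Set.InjOn (fun c : ℤ => (c : ZMod n)) C)
    (hV : ∀ c ∈ C, ∀ x, 0 < V c x) (i j : Fin n) :
    (if 0 < diagonalSquare C η τ V i j then 1 else 0)
      = diagonalSquare C η τ (fun _ _ => 1) i j := by
  by_cases h : ∃ c ∈ C, (c : ZMod n) = residue j - 2 * residue i - η
  · obtain ⟨c, hc, h⟩ := h
    rw [diagonalSquare_apply hC hc h, diagonalSquare_apply hC hc h, if_pos (hV c hc _)]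
  · rw [if_neg fun h' => h (exists_of_diagonalSquare_pos h')]
    exact (Nat.eq_zero_of_not_pos fun h' => h (exists_of_diagonalSquare_pos h')).symm

end Sums

/-- A linear system with determinant 2/3, a unit; hence a filling may prescribe α and β freely. -/
theorem exists_diagonal_parameters {n : ℕ} {e : ZMod n} (he : 6 * e = 1) (α β : ZMod n) :
    ∃ η τ : ZMod n, τ - η = α ∧ τ - 2 * e * (1 + η) = β := by
  refine ⟨9 * e * (2 * e - α + β), α + 9 * e * (2 * e - α + β), by ring, ?_⟩
  linear_combination (α - β - 2 * e) * (3 * e - 1) * he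

theorem IsFilling.exists_eq {n : ℕ} [NeZero n] {m : ℤ} (hm : (n : ℤ) = 2 * m + 1) {e α β : ZMod n}
    {C : Finset ℤ} {F : ℤ → ZMod n → ℤ} {R Y : ZMod n → ℤ} {D₁ D₂ : ℤ}
    (h : IsFilling m e α β C F R Y D₁ D₂) {c : ℤ} (hc : c ∈ C) {v : ℤ} (h₁ : -m ≤ v) (h₂ : v ≤ m) :
    ∃ x, F c x = v := by
  have himg : Finset.univ.image (F c) = Finset.Icc (-m) m := by
    refine Finset.eq_of_subset_of_card_le (fun v hv => ?_) ?_
    · obtain ⟨x, -, rfl⟩ := Finset.mem_image.mp hv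
      exact Finset.mem_Icc.mpr ⟨h.lower c hc x, h.upper c hc x⟩
    · rw [Finset.card_image_of_injective _ (h.inj c hc), Finset.card_univ, ZMod.card, Int.card_Icc]
      omega
  have hv : v ∈ Finset.univ.image (F c) := himg ▸ Finset.mem_Icc.mpr ⟨h₁, h₂⟩
  obtain ⟨x, -, hx⟩ := Finset.mem_image.mp hv
  exact ⟨x, hx⟩

/-- A filling of `d` distinct classes whose sums are `2 n + 2` consecutive integers yields a regular
sparse anti-magic square. -/
theorem IsFilling.exists_isRegularSAMS {n : ℕ} [NeZero n] {m : ℤ} (hm : (n : ℤ) = 2 * m + 1)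
    {e α β : ZMod n} (he : 6 * e = 1) {C : Finset ℤ} {F : ℤ → ZMod n → ℤ} {R Y : ZMod n → ℤ}
    {D₁ D₂ : ℤ} (h : IsFilling m e α β C F R Y D₁ D₂) {a : ℤ} (hC : C ⊆ Finset.Ico a (a + n))
    (hpos : 0 < C.card) (hlt : C.card < n)
    (hsum : Set.range R ∪ Set.range Y ∪ {D₁, D₂} = Set.Icc (-n : ℤ) (n + 1)) :
    ∃ A : Matrix (Fin n) (Fin n) ℕ, IsRegularSAMS n C.card A := by
  obtain ⟨η, τ, hα, hβ⟩ := exists_diagonal_parameters he α β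
  have hinj : Set.InjOn (fun c : ℤ => (c : ZMod n)) C := by
    intro c hc c' hc' hcc
    have h₁ := Finset.mem_Ico.mp (hC hc)
    have h₂ := Finset.mem_Ico.mp (hC hc')
    obtain ⟨k, hk⟩ := (intCast_eq_intCast_iff_dvd_sub c c' n).mp hcc
    have hn : (0 : ℤ) < n := by exact_mod_cast NeZero.pos n
    have hk₁ : k < 1 := by
      by_contra! hk₁
      nlinarith
    have hk₂ : -1 < k := by
      by_contra! hk₂
      nlinarith
    obtain rfl : k = 0 := by omega
    rw [mul_zero] at hk
    omega
  obtain ⟨idx, hidx⟩ : ∃ idx : ℤ → ℕ, Set.BijOn idx C (Set.Iio C.card) := by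
    let f := C.equivFin
    refine ⟨fun c => if hc : c ∈ C then f ⟨c, hc⟩ else 0, ?_, ?_, ?_⟩
    · intro c hc
      have hc : c ∈ C := hc
      simp only [dif_pos hc]
      exact (f ⟨c, hc⟩).2
    · intro c hc c' hc' hcc
      have hc : c ∈ C := hc
      have hc' : c' ∈ C := hc'
      simp only [dif_pos hc, dif_pos hc'] at hcc
      exact congrArg Subtype.val (f.injective (Fin.ext hcc))
    · intro k hk
      refine ⟨f.symm ⟨k, hk⟩, (f.symm ⟨k, hk⟩).2, ?_⟩
      simp only [dif_pos (f.symm ⟨k, hk⟩).2, Subtype.coe_eta, Equiv.apply_symm_apply]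
  -- Block `idx c` is the interval from `idx c * n + 1` to `idx c * n + n`; the order of the blocks
  -- is irrelevant.
  set V : ℤ → ZMod n → ℕ := fun c x => idx c * n + (m + 1 + F c x).toNat with hV
  have offset : ∀ c ∈ C, ∀ x, ((m + 1 + F c x).toNat : ℤ) = m + 1 + F c x := fun c hc x =>
    Int.toNat_of_nonneg (by linarith [h.lower c hc x])
  have offset_pos : ∀ c ∈ C, ∀ x, 1 ≤ (m + 1 + F c x).toNat := fun c hc x => by
    have := offset c hc x
    have := h.lower c hc x
    omega
  have offset_le : ∀ c ∈ C, ∀ x, (m + 1 + F c x).toNat ≤ n := fun c hc x => by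
    have := offset c hc x
    have := h.upper c hc x
    omega
  have Vpos : ∀ c ∈ C, ∀ x, 0 < V c x := fun c hc x =>
    (offset_pos c hc x).trans (Nat.le_add_left _ _)
  have Vle : ∀ c ∈ C, ∀ x, V c x ≤ n * C.card := fun c hc x => by
    have h₁ : idx c + 1 ≤ C.card := hidx.mapsTo hc
    calc V c x ≤ idx c * n + n := Nat.add_le_add_left (offset_le c hc x) _
      _ = n * (idx c + 1) := by ring
      _ ≤ n * C.card := Nat.mul_le_mul_left n h₁
  have Vinj : ∀ c ∈ C, ∀ c' ∈ C, ∀ x x', V c x = V c' x' → c = c' ∧ x = x' := by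
    intro c hc c' hc' x x' hVV
    have h₁ := offset_pos c hc x
    have h₂ := offset_le c hc x
    have h₁' := offset_pos c' hc' x'
    have h₂' := offset_le c' hc' x'
    have hi : idx c = idx c' := by
      have hVV : idx c * n + (m + 1 + F c x).toNat = idx c' * n + (m + 1 + F c' x').toNat := hVV
      rcases lt_trichotomy (idx c) (idx c') with hlt | heq | hlt
      · have := Nat.mul_le_mul_right n (Nat.succ_le_of_lt hlt)
        rw [Nat.succ_mul] at this
        omega
      · exact heq
      · have := Nat.mul_le_mul_right n (Nat.succ_le_of_lt hlt)
        rw [Nat.succ_mul] at this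
        omega
    obtain rfl := hidx.injOn hc hc' hi
    have hVV : idx c * n + (m + 1 + F c x).toNat = idx c * n + (m + 1 + F c x').toNat := hVV
    have o := offset c hc x
    have o' := offset c hc x'
    exact ⟨rfl, h.inj c hc (by omega)⟩
  have Vsurj : ∀ k, 1 ≤ k → k ≤ n * C.card → ∃ c ∈ C, ∃ x, V c x = k := by
    intro k hk₁ hk₂
    have hn := NeZero.pos n
    obtain ⟨c, hc, hck⟩ := hidx.surjOn (show (k - 1) / n ∈ Set.Iio C.card from
      Nat.div_lt_of_lt_mul (by omega))
    have hmod := Nat.mod_lt (k - 1) hn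
    obtain ⟨x, hx⟩ := h.exists_eq hm hc (v := ((k - 1) % n : ℕ) - m) (by omega) (by omega)
    refine ⟨c, hc, x, ?_⟩
    have o := offset c hc x
    have hdm := Nat.div_add_mod' (k - 1) n
    simp only [hV]
    rw [hck]
    omega
  set K : ℤ := ∑ c ∈ C, ((idx c : ℤ) * n + (m + 1)) with hK
  have sumV : ∀ g : ℤ → ZMod n, ((∑ c ∈ C, V c (g c) : ℕ) : ℤ) = K + ∑ c ∈ C, F c (g c) := by
    intro g
    rw [hK, ← Finset.sum_add_distrib, Nat.cast_sum]
    refine Finset.sum_congr rfl fun c hc => ?_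
    simp only [hV]
    rw [Nat.cast_add, offset c hc, Nat.cast_mul]
    ring
  set A := diagonalSquare C η τ V with hA
  have hrow : ∀ i, (rowSum A i : ℤ) = K + R (residue i + τ) := fun i => by
    unfold rowSum
    rw [hA, diagonalSquare_row, sumV fun _ => residue i + τ, h.row]
  have hcol : ∀ j, (colSum A j : ℤ) = K + Y (3 * e * (residue j - η) + τ) := fun j => by
    unfold colSum
    rw [hA, diagonalSquare_col _ _ _ _ he, sumV fun c => 3 * e * (residue j - η) + τ - 3 * e * c, h.col]
  have hleft : (leftDiagSum A : ℤ) = K + D₁ := by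
    unfold leftDiagSum
    rw [hA, diagonalSquare_leftDiag, hα, sumV fun c => α - c, h.diag]
  have hright : (rightDiagSum A : ℤ) = K + D₂ := by
    unfold rightDiagSum
    rw [hA, diagonalSquare_rightDiag _ _ _ _ he, hβ, sumV fun c => β - 2 * e * c, h.antidiag]
  have mem_sumSet : ∀ s : ℕ, s ∈ sumSet A ↔ (s : ℤ) - K ∈ Set.Icc (-n : ℤ) (n + 1) := by
    intro s
    rw [← hsum]
    simp only [sumSet, Set.mem_union, Set.mem_range, Set.mem_insert_iff, Set.mem_singleton_iff]
    refine or_congr (or_congr ⟨?_, ?_⟩ ⟨?_, ?_⟩) (or_congr ?_ ?_)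
    · rintro ⟨i, rfl⟩
      exact ⟨residue i + τ, by rw [hrow]; ring⟩
    · rintro ⟨x, hx⟩
      obtain ⟨i, hi⟩ := bijective_residue.surjective (x - τ)
      refine ⟨i, ?_⟩
      have := hrow i
      rw [hi, sub_add_cancel, hx] at this
      omega
    · rintro ⟨j, rfl⟩
      exact ⟨_, by rw [hcol]; ring⟩
    · rintro ⟨y, hy⟩
      obtain ⟨j, hj⟩ := bijective_residue.surjective (2 * (y - τ) + η)
      refine ⟨j, ?_⟩
      have := hcol j
      have harg : 3 * e * (2 * (y - τ) + η - η) + τ = y := by linear_combination (y - τ) * he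
      rw [hj, harg, hy] at this
      omega
    · omega
    · omega
  -- The value -n is attained by some line, whose actual sum K - n is a sum of naturals; so the
  -- truncation in `(K - n).toNat` is harmless.
  have hKn : 0 ≤ K - n := by
    have hmem : (-n : ℤ) ∈ Set.range R ∪ Set.range Y ∪ {D₁, D₂} := by
      rw [hsum]
      constructor <;> omega
    rcases hmem with (⟨x, hx⟩ | ⟨y, hy⟩) | hD | hD
    · have := sumV fun _ => x
      rw [h.row, hx] at this
      omega
    · have := sumV fun c => y - 3 * e * c
      rw [h.col, hy] at this
      omega
    · omega
    · have hD : (-n : ℤ) = D₂ := hD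
      omega
  have count : ∀ p : Fin n → Fin n × Fin n,
      (Finset.univ.filter fun i => 0 < A (p i).1 (p i).2).card
        = ∑ i, diagonalSquare C η τ (fun _ _ => 1) (p i).1 (p i).2 := fun p => by
    rw [Finset.card_filter]
    exact Finset.sum_congr rfl fun i _ => ite_diagonalSquare_pos hinj Vpos _ _
  have apply_eq : ∀ i j, 0 < A i j → ∃ c ∈ C, (c : ZMod n) = residue j - 2 * residue i - η ∧
      A i j = V c (residue i + τ) := fun i j hij => by
    obtain ⟨c, hc, hcij⟩ := exists_of_diagonalSquare_pos hij
    exact ⟨c, hc, hcij, diagonalSquare_apply hinj hc hcij⟩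
  refine ⟨A, ⟨⟨hpos, hlt, ?_, ?_, ⟨(K - n).toNat, ?_⟩⟩, ?_, ?_, ?_, ?_⟩⟩
  · intro i j
    rcases Nat.eq_zero_or_pos (A i j) with h0 | hij
    · rw [h0]; exact Nat.zero_le _
    · obtain ⟨c, hc, -, hA'⟩ := apply_eq i j hij
      rw [hA']
      exact Vle c hc _
  · rintro k ⟨hk₁, hk₂⟩
    obtain ⟨c, hc, x, hx⟩ := Vsurj k hk₁ hk₂
    obtain ⟨i, hi⟩ := bijective_residue.surjective (x - τ)
    obtain ⟨j, hj⟩ := bijective_residue.surjective ((c : ZMod n) + 2 * residue i + η)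
    refine ⟨(i, j), ?_, ?_⟩
    · show A i j = k
      rw [hA, diagonalSquare_apply hinj hc (by rw [hj]; ring), hi, sub_add_cancel, hx]
    · rintro ⟨i', j'⟩ hk
      have hk : A i' j' = k := hk
      obtain ⟨c', hc', hij, hA'⟩ := apply_eq i' j' (by omega)
      obtain ⟨rfl, hxx⟩ := Vinj c' hc' c hc (residue i' + τ) x (by rw [← hA', hk, hx])
      have hii : i' = i := bijective_residue.injective (by rw [hi, ← hxx]; ring)
      subst hii
      rw [Prod.mk.injEq]
      exact ⟨rfl, bijective_residue.injective (by rw [hj, hij]; ring)⟩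
  · ext s
    rw [mem_sumSet, Set.mem_Icc, Set.mem_Icc]
    omega
  · intro i
    rw [count fun j => (i, j), diagonalSquare_row, Finset.sum_const, smul_eq_mul, mul_one]
  · intro j
    rw [count fun i => (i, j), diagonalSquare_col _ _ _ _ he, Finset.sum_const, smul_eq_mul, mul_one]
  · rw [count fun i => (i, i), diagonalSquare_leftDiag, Finset.sum_const, smul_eq_mul, mul_one]
  · rw [count fun i => (i, i.rev), diagonalSquare_rightDiag _ _ _ _ he, Finset.sum_const, smul_eq_mul,
      mul_one]

/-- Enlarging a base filling with zero sums to reach every density `d` in its class modulo `4`. -/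
theorem IsFilling.exists_isRegularSAMS_add {n : ℕ} [NeZero n] {m : ℤ} (hm : (n : ℤ) = 2 * m + 1)
    (hn : 9 ≤ n) {e α β : ZMod n} (he : 6 * e = 1) {C : Finset ℤ} {F : ℤ → ZMod n → ℤ}
    {R Y : ZMod n → ℤ} {D₁ D₂ : ℤ} (h : IsFilling m e α β C F R Y D₁ D₂) {a b : ℤ} (hab : a ≤ b)
    (hC : C ⊆ Finset.Ico a b) (hpos : 0 < C.card)
    (hsum : Set.range R ∪ Set.range Y ∪ {D₁, D₂} = Set.Icc (-n : ℤ) (n + 1)) (q : ℕ)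
    (hlt : C.card + 4 * q < n) (hq : b - a + 4 * q ≤ n) :
    ∃ A : Matrix (Fin n) (Fin n) ℕ, IsRegularSAMS n (C.card + 4 * q) A := by
  obtain ⟨C', F', h', hcard, hsub⟩ := h.exists_extension hm hn he hab hC q
  rw [← hcard] at hlt ⊢
  exact h'.exists_isRegularSAMS hm he
    (hsub.trans (Finset.Ico_subset_Ico_right (by linarith))) (by omega) hlt hsum

theorem exists_isRegularSAMS (n d : ℕ) (hn : 11 ≤ n) (hmod : n ≡ 1 [MOD 6] ∨ n ≡ 5 [MOD 6])
    (hd : d ∈ Set.Icc 6 (n - 3)) :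
    ∃ A : Matrix (Fin n) (Fin n) ℕ, IsRegularSAMS n d A := by
  obtain ⟨hd₁, hd₂⟩ := hd
  have : NeZero n := ⟨by omega⟩
  obtain ⟨m, hm⟩ : ∃ m : ℤ, (n : ℤ) = 2 * m + 1 := ⟨n / 2, by
    rcases hmod with h | h <;> unfold Nat.ModEq at h <;> omega⟩
  obtain ⟨l, E, hl, hlE⟩ : ∃ l E : ℤ, 2 ≤ l ∧
      ((n : ℤ) = 6 * l + 1 ∧ E = -l ∨ (n : ℤ) = 6 * l - 1 ∧ E = l) := by
    rcases hmod with h | h <;> unfold Nat.ModEq at h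
    · exact ⟨n / 6, -(n / 6), by omega, Or.inl ⟨by omega, rfl⟩⟩
    · exact ⟨n / 6 + 1, n / 6 + 1, by omega, Or.inr ⟨by omega, rfl⟩⟩
  have he : (6 : ZMod n) * (E : ZMod n) = 1 := by
    have h0 : ((n : ℤ) : ZMod n) = 0 := by rw [Int.cast_natCast, ZMod.natCast_self]
    rcases hlE with ⟨h, rfl⟩ | ⟨h, rfl⟩ <;> rw [h] at h0 <;> push_cast at h0 ⊢
    · linear_combination -h0
    · linear_combination h0
  have hm₁ : 1 ≤ m := by omega
  -- The base classes lie in windows of length 6, 7, 7, 7, at most two more than their number; so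
  -- the enlarged window has length at most d + 2 < n and distinct classes stay distinct mod n.
  obtain ⟨q, hq⟩ : ∃ q, d = 4 + 4 * q ∨ d = 5 + 4 * q ∨ d = 6 + 4 * q ∨ d = 7 + 4 * q :=
    ⟨(d - 4) / 4, by omega⟩
  rcases hq with rfl | rfl | rfl | rfl
  · obtain ⟨α, β, F, h⟩ := exists_isFilling_four hm he hl rfl hlE
    exact h.exists_isRegularSAMS_add hm (by omega) he (a := -3) (b := 3) (by omega) (by decide)
      (by decide) (sums_even hm hm₁ he) q (by simp; omega) (by omega)
  · obtain ⟨α, β, F, h⟩ := exists_isFilling_five hm he hl rfl hlE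
    exact h.exists_isRegularSAMS_add hm (by omega) he (a := -4) (b := 3) (by omega) (by decide)
      (by decide) (sums_odd hm hm₁ he) q (by simp; omega) (by omega)
  · obtain ⟨α, β, F, h⟩ := exists_isFilling_six hm he hl rfl hlE
    exact h.exists_isRegularSAMS_add hm (by omega) he (a := -4) (b := 3) (by omega) (by decide)
      (by decide) (by rw [Set.pair_comm]; exact sums_even hm hm₁ he) q (by simp; omega) (by omega)
  · obtain ⟨α, β, F, h⟩ := exists_isFilling_seven hm he hl rfl hlE
    exact h.exists_isRegularSAMS_add hm (by omega) he (a := -5) (b := 2) (by omega) (by decide)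
      (by decide) (by rw [Set.pair_comm]; exact sums_odd hm hm₁ he) q (by simp; omega) (by omega)

end SparseSquare

theorem theorem4p4 (n d : ℕ) (hn : 11 ≤ n) (hmod : n ≡ 1 [MOD 6] ∨ n ≡ 5 [MOD 6])
    (hd : d ∈ Set.Icc 6 (n - 3)) :
    ∃ A : Matrix (Fin n) (Fin n) ℕ, SparseSquare.IsRegularSAMS n d A :=
  SparseSquare.exists_isRegularSAMS n d hn hmod hd
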